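/- Let $p,q,r\in[0,1]$ satisfy $p+r+q=1$ and $p>q>0$, let $a\in(0,1)$, and let $P$ be the transition kernel of the birth-and-death chain on $\mathbb N=\{0,1,2,\dots\}$ given by $P(0,0)=a$, $P(0,1)=1-a$ and, for every $n\ge 1$, $P(n,n-1)=p$, $P(n,n)=r$, $P(n,n+1)=q$. Put $\hat\gamma=\sqrt{p/q}$ and $V(n)=\hat\gamma^{\,n}$. For $f:\mathbb N\to\mathbb C$ let $\|f\|_V=\sup_{n}|f(n)|/V(n)$. Then $P$ is $V$-geometrically ergodic: it has an invariant probability measure $\pi$ with $\pi(V)<\infty$, and there are $c>0$ and $\rho\in(0,1)$ with $\sup_{\|f\|_V\le 1}\|P^nf-\pi(f)1\|_V\le c\rho^n$ for all $n\ge 0$. Furthermore, let $$\rho_{\hat\gamma}(P)=\inf\Big\{\rho\in(0,1):\ \sup_{\|f\|_V\le 1}\|P^nf-\pi(f)1\|_V=O(\rho^n)\Big\},$$ where $\pi$ is any invariant probability measure of $P$ with $\pi(V)<\infty$, and set $a_0=1-q-\sqrt{pq}$ and $a_1=p-\sqrt{pq}-\sqrt{r(r+2\sqrt{pq})}$. Then: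 - if $a\in(a_0,1)$, then $\rho_{\hat\gamma}(P)=r+2\sqrt{pq}$; - if $a\in(0,a_0]$ and $2p\le(1-q+\sqrt{pq})^2$, then $\rho_{\hat\gamma}(P)=r+2\sqrt{pq}$; - if $a\in(0,a_0]$ and $2p>(1-q+\sqrt{pq})^2$, then $\rho_{\hat\gamma}(P)=\left|a+\dfrac{p(1-a)}{a-1+q}\right|$ when $a\le a_1$, and $\rho_{\hat\gamma}(P)=r+2\sqrt{pq}$ when $a\ge a_1$. -/

import Mathlib

open MeasureTheory ProbabilityTheory Filter
open scoped ENNReal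

/-- The transition kernel on `ℕ` of the birth-and-death chain with
`P(0,0) = a`, `P(0,1) = 1 - a` and, for `n ≥ 1`,
`P(n,n-1) = p`, `P(n,n) = r`, `P(n,n+1) = q`. -/
noncomputable def birthDeathKernel (a p r q : ℝ) : Kernel ℕ ℕ :=
  Kernel.ofFunOfCountable fun n => match n with
    | 0 => ENNReal.ofReal a • Measure.dirac 0 + ENNReal.ofReal (1 - a) • Measure.dirac 1
    | m + 1 => ENNReal.ofReal p • Measure.dirac m + ENNReal.ofReal r • Measure.dirac (m + 1)
        + ENNReal.ofReal q • Measure.dirac (m + 2)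

/-- The weight function `V_γ(n) = γ ^ n` on `ℕ`. -/
noncomputable def geometricWeight (γ : ℝ) (n : ℕ) : ℝ := γ ^ n

section Ergodicity

variable {X : Type*} [MeasurableSpace X]

/-- `sup_{‖f‖_V ≤ 1} ‖Pⁿ f - π(f) 1‖_V`, an element of `[0, ∞]`, where
`‖f‖_V = sup_x |f x| / V x`, the functions `f : X → ℂ` are measurable and
`(Pⁿ f)(x) = ∫ f(y) Pⁿ(x, dy)`; here `V` takes its values in `[1, ∞)`. -/
noncomputable def vDeviation (P : Kernel X X) (V : X → ℝ) (π : Measure X) (n : ℕ) : ℝ≥0∞ :=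
  ⨆ (f : X → ℂ) (_ : Measurable f) (_ : ∀ x, ‖f x‖ ≤ V x) (x : X),
    ENNReal.ofReal (‖(∫ y, f y ∂((P ^ n) x)) - ∫ y, f y ∂π‖ / V x)

/-- `π` is a `P`-invariant probability measure with `π(V) < ∞`. -/
structure IsVInvariantProbability (P : Kernel X X) (V : X → ℝ) (π : Measure X) : Prop where
  isProbabilityMeasure : IsProbabilityMeasure π
  invariant : P.Invariant π
  integrable : Integrable V π

/-- `V`-geometric ergodicity: `V` is integrable under all iterates of `P` (so that every `Pⁿ f`
with `‖f‖_V < ∞` is well defined) and, for some invariant probability measure `π` with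
`π(V) < ∞`, some `ρ ∈ (0, 1)` and some `c > 0`, one has
`‖Pⁿ f - π(f) 1‖_V ≤ c ρⁿ` for all `n` and all `f` with `‖f‖_V ≤ 1`. -/
def IsVGeometricallyErgodic (P : Kernel X X) (V : X → ℝ) : Prop :=
  (∀ (n : ℕ) (x : X), Integrable V ((P ^ n) x)) ∧
  ∃ π : Measure X, IsVInvariantProbability P V π ∧
    ∃ ρ ∈ Set.Ioo (0 : ℝ) 1, ∃ c > (0 : ℝ), ∀ n : ℕ,
      vDeviation P V π n ≤ ENNReal.ofReal (c * ρ ^ n)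

/-- The convergence rate
`ρ_V(P) = inf {ρ ∈ (0,1) : sup_{‖f‖_V ≤ 1} ‖Pⁿ f - π(f) 1‖_V = O(ρⁿ)}`. -/
noncomputable def vConvergenceRate (P : Kernel X X) (V : X → ℝ) (π : Measure X) : ℝ :=
  sInf {ρ : ℝ | ρ ∈ Set.Ioo (0 : ℝ) 1 ∧
    ∃ c : ℝ, ∀ᶠ n : ℕ in atTop, vDeviation P V π n ≤ ENNReal.ofReal (c * ρ ^ n)}

end Ergodicity

/-! Write γ = √(p/q) and s = √(pq), so that p = sγ and s = qγ. Dividing functions by V turns `P`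
into the operator Q = `toeplitzOp a ((1 - a) * γ) r s` on bounded sequences, symmetric off the first
row. The deviation from π then becomes the operator norm of Qⁿ - φ ⊗ u, where φ(g) = π(Vg) and u =
1/V is the image of the constant function 1.

Upper bound. A number l with |l| > r + 2s is r + s(z + z⁻¹) with 0 < |z| < 1, and the bounded
solutions of the recursion off the origin are the multiples of zⁿ. The first row adds the condition
r + s(z + z⁻¹) = a + (1 - a)γz, which factors as (γz - 1)((a - 1 + q)z - s) = 0
(`boundary_equation_iff`). The first root gives the eigenvalue 1; the second lies in the open disc
only if a < a₀ and gives `boundaryEigenvalue`. Subtracting φ ⊗ u removes the eigenvalue 1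
(`spectrum_deflation_subset`), and Gelfand's formula turns the remaining spectral bound into a rate.

Lower bound. An eigenvector whose eigenvalue l is not 1 is killed by φ, so |l| bounds every
admissible rate from below (`norm_eigenvalue_le_of_vDeviation_le`). The eigenvalues used are r + 2s
cos θ with θ → 0, and `boundaryEigenvalue` when a < a₀.

The rate is therefore r + 2s, or its maximum with |`boundaryEigenvalue`| if a < a₀. With d = 1 - q -
a that eigenvalue is r - (d + s²/d), and comparing it with r + 2s is a quadratic inequality whose
threshold is a₁. -/

open scoped BoundedContinuousFunction Topology

/-! ### The conjugated operator and its resolvent off the origin -/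

section ToeplitzOperator

/-- The Jacobi-type matrix with constant off-diagonal entries `s` and diagonal entries `r`, except
that its first row is `(a, b, 0, …)`, acting on the bounded sequences. -/
noncomputable def toeplitzOp (a b r s : ℝ) : (ℕ →ᵇ ℂ) →L[ℂ] (ℕ →ᵇ ℂ) :=
  LinearMap.mkContinuous
    { toFun := fun g => BoundedContinuousFunction.ofNormedAddCommGroupDiscrete
        (fun n => match n with
          | 0 => a * g 0 + b * g 1
          | n + 1 => s * g n + r * g (n + 1) + s * g (n + 2))
        ((|a| + |b| + |r| + 2 * |s|) * ‖g‖) (by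
          have hg : ∀ (c : ℝ) m, ‖(c : ℂ) * g m‖ ≤ |c| * ‖g‖ := fun c m => by
            rw [norm_mul, Complex.norm_real, Real.norm_eq_abs]
            gcongr
            exact g.norm_coe_le_norm m
          have h0 : ∀ c : ℝ, 0 ≤ |c| * ‖g‖ := fun c => by positivity
          rintro (_ | n)
          · refine (norm_add_le _ _).trans ?_
            linarith [hg a 0, hg b 1, h0 r, h0 s]
          · refine (norm_add₃_le).trans ?_
            linarith [hg s n, hg r (n + 1), hg s (n + 2), h0 a, h0 b])
      map_add' := fun f g => by
        ext n
        rcases n with _ | n <;> simp <;> ring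
      map_smul' := fun c g => by
        ext n
        rcases n with _ | n <;> simp <;> ring }
    (|a| + |b| + |r| + 2 * |s|) (fun g => BoundedContinuousFunction.norm_le (by positivity) |>.2
      fun n => by
        have hg : ∀ (c : ℝ) m, ‖(c : ℂ) * g m‖ ≤ |c| * ‖g‖ := fun c m => by
          rw [norm_mul, Complex.norm_real, Real.norm_eq_abs]
          gcongr
          exact g.norm_coe_le_norm m
        have h0 : ∀ c : ℝ, 0 ≤ |c| * ‖g‖ := fun c => by positivity
        rcases n with _ | n
        · refine (norm_add_le _ _).trans ?_
          linarith [hg a 0, hg b 1, h0 r, h0 s]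
        · refine (norm_add₃_le).trans ?_
          linarith [hg s n, hg r (n + 1), hg s (n + 2), h0 a, h0 b])

variable {a b r s : ℝ}

@[simp] lemma toeplitzOp_zero (g : ℕ →ᵇ ℂ) : toeplitzOp a b r s g 0 = a * g 0 + b * g 1 := rfl

@[simp] lemma toeplitzOp_succ (g : ℕ →ᵇ ℂ) (n : ℕ) :
    toeplitzOp a b r s g (n + 1) = s * g n + r * g (n + 1) + s * g (n + 2) := rfl

/-- The geometric sequence `z ^ n` with `‖z‖ ≤ 1`, as a bounded sequence. -/
noncomputable def geometricSeq (z : ℂ) (hz : ‖z‖ ≤ 1) : ℕ →ᵇ ℂ :=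
  BoundedContinuousFunction.ofNormedAddCommGroupDiscrete (fun n => z ^ n) 1
    (fun n => by rw [norm_pow]; exact pow_le_one₀ (norm_nonneg z) hz)

@[simp] lemma geometricSeq_apply (z : ℂ) (hz : ‖z‖ ≤ 1) (n : ℕ) : geometricSeq z hz n = z ^ n := rfl

/-- The second-order recursion splits into two first-order ones with ratios z⁻¹ and z. The expanding
one is solved here from infinity by a Neumann series, which leaves no free constant; the contracting
one is then solved forward from any initial value. -/
lemma exists_backward_recursion {z : ℂ} (hz : ‖z‖ < 1) (f : ℕ →ᵇ ℂ) :
    ∃ k : ℕ →ᵇ ℂ, ∀ n, k n = z * k (n + 1) + f n := by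
  have hb : ∀ n j, ‖z ^ j * f (n + j)‖ ≤ ‖z‖ ^ j * ‖f‖ := fun n j => by
    rw [norm_mul, norm_pow]
    gcongr
    exact f.norm_coe_le_norm _
  have hs : Summable fun j => ‖z‖ ^ j * ‖f‖ :=
    (summable_geometric_of_lt_one (norm_nonneg z) hz).mul_right _
  refine ⟨BoundedContinuousFunction.ofNormedAddCommGroupDiscrete
    (fun n => ∑' j, z ^ j * f (n + j)) (∑' j, ‖z‖ ^ j * ‖f‖)
    (fun n => tsum_of_norm_bounded hs.hasSum (hb n)), fun n => ?_⟩
  change ∑' j, z ^ j * f (n + j) = z * (∑' j, z ^ j * f (n + 1 + j)) + f n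
  rw [(Summable.of_norm_bounded hs (hb n)).tsum_eq_zero_add, ← tsum_mul_left]
  simp only [pow_zero, add_zero, one_mul]
  rw [add_comm]
  congr 1
  refine tsum_congr fun j => ?_
  rw [pow_succ', mul_assoc, add_right_comm, add_assoc n]

lemma exists_forward_recursion {z : ℂ} (hz : ‖z‖ < 1) (k : ℕ →ᵇ ℂ) (c : ℂ) :
    ∃ g : ℕ →ᵇ ℂ, g 0 = c ∧ ∀ n, g (n + 1) = z * g n + k n := by
  let g : ℕ → ℂ := fun n => Nat.rec c (fun n x => z * x + k n) n
  have hd : 0 < 1 - ‖z‖ := sub_pos.2 hz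
  refine ⟨BoundedContinuousFunction.ofNormedAddCommGroupDiscrete g (‖c‖ + ‖k‖ / (1 - ‖z‖)) ?_,
    rfl, fun n => rfl⟩
  intro n
  induction n with
  | zero =>
    change ‖c‖ ≤ _
    have : 0 ≤ ‖k‖ / (1 - ‖z‖) := by positivity
    linarith
  | succ n ih =>
    change ‖z * g n + k n‖ ≤ _
    have h1 : ‖z * g n + k n‖ ≤ ‖z‖ * (‖c‖ + ‖k‖ / (1 - ‖z‖)) + ‖k‖ := by
      refine (norm_add_le _ _).trans ?_
      rw [norm_mul]
      gcongr
      exact k.norm_coe_le_norm n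
    have h2 : ‖k‖ = (1 - ‖z‖) * (‖k‖ / (1 - ‖z‖)) := by field_simp
    have h3 : ‖z‖ * ‖c‖ ≤ ‖c‖ := mul_le_of_le_one_left (norm_nonneg c) hz.le
    linarith

/-- The solutions of `(λ - Q) g = f` off the origin, where `λ = r + s (z + z⁻¹)`. -/
lemma exists_resolvent_off_origin (hs : s ≠ 0) {z : ℂ} (hz0 : z ≠ 0) (hz : ‖z‖ < 1)
    (f : ℕ →ᵇ ℂ) : ∃ w : ℂ, ∀ c : ℂ, ∃ g : ℕ →ᵇ ℂ, g 0 = c ∧ g 1 = z * c + w ∧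
      ∀ n, (r + s * (z + z⁻¹)) * g (n + 1) - toeplitzOp a b r s g (n + 1) = f (n + 1) := by
  have hsC : (s : ℂ) ≠ 0 := Complex.ofReal_ne_zero.2 hs
  -- `k n` plays the role of g(n+1) - z g(n). It depends on `f` only, so `w = k 0` does not depend
  -- on the initial value `c`.
  obtain ⟨k, hk⟩ := exists_backward_recursion hz
    ((z / s) • f.compContinuous ⟨fun n : ℕ => n + 1, continuous_of_discreteTopology⟩)
  refine ⟨k 0, fun c => ?_⟩
  obtain ⟨g, hg0, hg⟩ := exists_forward_recursion hz k c
  refine ⟨g, hg0, by rw [← hg0]; exact hg 0, fun n => ?_⟩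
  have h1 := hk n
  simp only [BoundedContinuousFunction.coe_smul, BoundedContinuousFunction.compContinuous_apply,
    ContinuousMap.coe_mk, smul_eq_mul] at h1
  rw [toeplitzOp_succ, hg (n + 1), hg n]
  have h2 : k (n + 1) = z⁻¹ * k n - f (n + 1) / s := by
    rw [h1]; field_simp; ring
  rw [h2]
  field_simp
  ring

/-- Bounded solutions of the homogeneous recursion are geometric. -/
lemma eq_geometric_of_homogeneous (hs : s ≠ 0) {z : ℂ} (hz0 : z ≠ 0) (hz : ‖z‖ < 1)
    (g : ℕ →ᵇ ℂ)
    (h : ∀ n, toeplitzOp a b r s g (n + 1) = (r + s * (z + z⁻¹)) * g (n + 1)) (n : ℕ) :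
    g n = z ^ n * g 0 := by
  have hsC : (s : ℂ) ≠ 0 := Complex.ofReal_ne_zero.2 hs
  -- The component along the growing solution z⁻ⁿ is bounded, so iterating this contraction toward
  -- infinity forces it to vanish.
  have hk : ∀ n, g (n + 1) - z * g n = z * (g (n + 2) - z * g (n + 1)) := fun n => by
    have h1 := h n
    rw [toeplitzOp_succ] at h1
    have h2 : g n + g (n + 2) = (z + z⁻¹) * g (n + 1) :=
      mul_left_cancel₀ hsC (by linear_combination h1)
    have h3 : g (n + 1) = z * (z⁻¹ * g (n + 1)) := by field_simp
    linear_combination (-z) * h2 + h3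
  have hk' : ∀ m n, g (n + 1) - z * g n = z ^ m * (g (n + m + 1) - z * g (n + m)) := by
    intro m
    induction m with
    | zero => intro n; simp
    | succ m ih =>
      intro n
      rw [ih n, hk (n + m), pow_succ, mul_assoc]
      rfl
  have hzero : ∀ n, g (n + 1) = z * g n := fun n => by
    rw [← sub_eq_zero, ← norm_le_zero_iff]
    have hlim : Tendsto (fun m : ℕ => ‖z‖ ^ m * (‖g‖ + ‖z‖ * ‖g‖)) atTop (𝓝 0) := by
      simpa using (tendsto_pow_atTop_nhds_zero_of_lt_one (norm_nonneg z) hz).mul_const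
        (‖g‖ + ‖z‖ * ‖g‖)
    refine ge_of_tendsto' hlim fun m => ?_
    rw [hk' m n, norm_mul, norm_pow]
    gcongr
    refine (norm_sub_le _ _).trans ?_
    rw [norm_mul]
    gcongr <;> exact g.norm_coe_le_norm _
  induction n with
  | zero => simp
  | succ n ih => rw [hzero, ih, pow_succ']; ring

/-- The Joukowski parametrization of the complement of `[r - 2s, r + 2s]`. -/
lemma exists_joukowski (hr : 0 ≤ r) (hs : 0 < s) {l : ℂ} (hl : r + 2 * s < ‖l‖) :
    ∃ z : ℂ, z ≠ 0 ∧ ‖z‖ < 1 ∧ l = r + s * (z + z⁻¹) := by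
  have hsC : (s : ℂ) ≠ 0 := Complex.ofReal_ne_zero.2 hs.ne'
  -- The two roots of z + z⁻¹ = (l - r)/s are mutually inverse; once the unit circle is excluded,
  -- exactly one lies inside the disc.
  have key : ∀ z : ℂ, z ≠ 0 → l = r + s * (z + z⁻¹) → ‖z‖ ≠ 1 := fun z hz0 hz h1 => by
    refine hl.not_ge ?_
    rw [hz]
    refine (norm_add_le _ _).trans ?_
    rw [norm_mul, Complex.norm_real, Complex.norm_real, Real.norm_of_nonneg hr,
      Real.norm_of_nonneg hs.le]
    have : ‖z + z⁻¹‖ ≤ 2 := by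
      refine (norm_add_le _ _).trans ?_
      rw [norm_inv, h1]
      norm_num
    nlinarith
  obtain ⟨d, hd⟩ := IsAlgClosed.exists_pow_nat_eq (((l - r) / s) ^ 2 - 4) (n := 2) two_pos
  set w := (l - r) / s with hw
  have hlw : l = r + s * w := by rw [hw]; field_simp; ring
  set z := (w + d) / 2 with hzdef
  have hquad : z ^ 2 - w * z + 1 = 0 := by rw [hzdef]; linear_combination (1 / 4) * hd
  have hz0 : z ≠ 0 := by rintro h; rw [h] at hquad; norm_num at hquad
  have hwz : w = z + z⁻¹ := by field_simp; linear_combination -hquad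
  have hlz : l = r + s * (z + z⁻¹) := by rw [← hwz]; exact hlw
  rcases lt_or_gt_of_ne (key z hz0 hlz) with h | h
  · exact ⟨z, hz0, h, hlz⟩
  · refine ⟨z⁻¹, inv_ne_zero hz0, ?_, by rw [inv_inv, add_comm z⁻¹]; exact hlz⟩
    rw [norm_inv]
    exact inv_lt_one_of_one_lt₀ h

/-- The sequence `(1, 0, 0, …)`. -/
noncomputable def originIndicator : ℕ →ᵇ ℂ := geometricSeq 0 (by simp)

@[simp] lemma originIndicator_zero : originIndicator 0 = 1 := pow_zero 0

@[simp] lemma originIndicator_succ (n : ℕ) : originIndicator (n + 1) = 0 := by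
  simp [originIndicator]

/-- Ignoring the first row costs only an error supported at the origin. This covers l = 1, where the
first row cannot be solved for g(0). -/
lemma exists_sub_toeplitzOp_eq_add (hs : s ≠ 0) {z : ℂ} (hz0 : z ≠ 0) (hz : ‖z‖ < 1)
    (f : ℕ →ᵇ ℂ) : ∃ (g : ℕ →ᵇ ℂ) (e : ℂ),
      (r + s * (z + z⁻¹)) • g - toeplitzOp a b r s g = f + e • originIndicator := by
  obtain ⟨w, hw⟩ := exists_resolvent_off_origin (a := a) (b := b) (r := r) hs hz0 hz f
  obtain ⟨g, -, -, hg⟩ := hw 0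
  refine ⟨g, ((r + s * (z + z⁻¹)) • g - toeplitzOp a b r s g - f) 0, ?_⟩
  ext n
  rcases n with _ | n
  · simp
  · simpa using hg n

lemma exists_sub_toeplitzOp_eq (hs : s ≠ 0) {z : ℂ} (hz0 : z ≠ 0) (hz : ‖z‖ < 1)
    (hB : r + s * (z + z⁻¹) ≠ a + b * z) (f : ℕ →ᵇ ℂ) :
    ∃ g : ℕ →ᵇ ℂ, (r + s * (z + z⁻¹)) • g - toeplitzOp a b r s g = f := by
  -- With g(1) = z g(0) + w, the first row is a linear equation for g(0) whose coefficient is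
  -- nonzero by `hB`.
  obtain ⟨w, hw⟩ := exists_resolvent_off_origin (a := a) (b := b) (r := r) hs hz0 hz f
  obtain ⟨g, hg0, hg1, hg⟩ := hw ((f 0 + b * w) / (r + s * (z + z⁻¹) - (a + b * z)))
  refine ⟨g, ?_⟩
  have hB' := sub_ne_zero.2 hB
  ext n
  rcases n with _ | n
  · simp only [BoundedContinuousFunction.coe_sub, BoundedContinuousFunction.coe_smul,
      Pi.sub_apply, smul_eq_mul, toeplitzOp_zero]
    rw [hg1, hg0]
    have := div_mul_cancel₀ (f 0 + b * w) hB'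
    linear_combination this
  · simpa using hg n

/-! ### Removing the eigenvalue 1 and bounding the powers -/

section Deflation

variable {φ : (ℕ →ᵇ ℂ) →L[ℂ] ℂ} {u : ℕ →ᵇ ℂ} {R : ℝ}

/-- Outside the disc the only solution of the boundary equation gives l = 1, whose eigenspace is
spanned by `u`; since `φ u = 1`, the rank-one term makes l - T invertible there too. -/
lemma spectrum_deflation_subset (hr : 0 ≤ r) (hs : 0 < s) (hR : r + 2 * s ≤ R)
    (hφ : ∀ g, φ (toeplitzOp a b r s g) = φ g) (hu : toeplitzOp a b r s u = u) (hφu : φ u = 1)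
    (hroot : ∀ z : ℂ, z ≠ 0 → ‖z‖ < 1 → r + s * (z + z⁻¹) = a + b * z →
      R < ‖r + s * (z + z⁻¹)‖ → r + s * (z + z⁻¹) = 1)
    {l : ℂ} (hl : l ∈ spectrum ℂ (toeplitzOp a b r s - φ.smulRight u)) : ‖l‖ ≤ R := by
  by_contra! hlR
  refine spectrum.mem_iff.1 hl (ContinuousLinearMap.isUnit_iff_bijective.2 ?_)
  set Q := toeplitzOp a b r s with hQ
  have hl0 : l ≠ 0 := by
    rintro rfl
    rw [norm_zero] at hlR
    linarith
  obtain ⟨z, hz0, hz, hlz⟩ := exists_joukowski hr hs (hR.trans_lt hlR)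
  have happ : ∀ g, (algebraMap ℂ ((ℕ →ᵇ ℂ) →L[ℂ] (ℕ →ᵇ ℂ)) l - (Q - φ.smulRight u)) g
      = l • g - Q g + φ g • u := fun g => by
    rw [Algebra.algebraMap_eq_smul_one]
    simp only [sub_apply, smul_apply, one_apply_eq_self, ContinuousLinearMap.smulRight_apply]
    abel
  -- `φ` is a left eigenvector of the deflated operator with eigenvalue 0, so for l ≠ 0 its kernel
  -- vectors satisfy `φ g = 0`.
  have hφl : ∀ g, φ (l • g - Q g + φ g • u) = l * φ g := fun g => by
    simp only [map_add, map_sub, map_smul, hφ, hφu, smul_eq_mul]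
    ring
  have hu0 : u 0 ≠ 0 ∧ (l = 1 → ∀ n, u n = z ^ n * u 0) ∨ l ≠ 1 := by
    by_cases h1 : l = 1
    · left
      have := eq_geometric_of_homogeneous (a := a) (b := b) (r := r) hs.ne' hz0 hz u fun n => by
        rw [← hQ, hu, ← hlz, h1, one_mul]
      refine ⟨fun h0 => ?_, fun _ => this⟩
      have hu' : u = 0 := by
        ext n
        simp [this n, h0]
      simp [hu'] at hφu
    · exact Or.inr h1
  have hB : l ≠ 1 → r + s * (z + z⁻¹) ≠ a + b * z := fun h1 h =>
    h1 (hlz.trans (hroot z hz0 hz h (hlz ▸ hlR)))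
  constructor
  · rw [injective_iff_map_eq_zero]
    intro g hg
    rw [happ] at hg
    have hφg : φ g = 0 := by
      have := hφl g
      rw [hg, map_zero] at this
      exact (mul_eq_zero.1 this.symm).resolve_left hl0
    rw [hφg, zero_smul, add_zero, sub_eq_zero] at hg
    have hgz := eq_geometric_of_homogeneous (a := a) (b := b) (r := r) hs.ne' hz0 hz g fun n => by
      rw [← hQ, ← hg, ← hlz]; rfl
    suffices h0 : g 0 = 0 by
      ext n
      simp [hgz n, h0]
    rcases eq_or_ne l 1 with h1 | h1
    · obtain ⟨hu0, huz⟩ := hu0.resolve_right (not_not.2 h1)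
      have : u 0 • g = g 0 • u := by
        ext n
        simp only [BoundedContinuousFunction.coe_smul, smul_eq_mul]
        rw [hgz n, huz h1 n]
        ring
      have h2 := congrArg φ this
      simpa [hφg, hφu] using h2.symm
    · have h0 : l * g 0 = a * g 0 + b * g 1 := congrArg (fun f : ℕ →ᵇ ℂ => f 0) hg
      rw [hgz 1, hlz] at h0
      by_contra hg0
      exact hB h1 (mul_right_cancel₀ hg0 (by linear_combination h0))
  · intro f
    have hsolve : ∀ f, φ f = 0 → ∃ g, l • g - Q g = f := by
      intro f hf
      rcases eq_or_ne l 1 with h1 | h1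
      · have key : ∀ f, ∃ (g : ℕ →ᵇ ℂ) (e : ℂ), l • g - Q g = f + e • originIndicator ∧
            φ f + e * φ originIndicator = 0 := fun f => by
          obtain ⟨g, e, hg⟩ :=
            exists_sub_toeplitzOp_eq_add (a := a) (b := b) (r := r) hs.ne' hz0 hz f
          rw [← hlz, ← hQ] at hg
          refine ⟨g, e, hg, ?_⟩
          have := congrArg φ hg
          simp only [map_sub, map_add, map_smul, smul_eq_mul, hφ, h1, one_mul, sub_self] at this
          exact this.symm
        -- Solvability at l = 1 up to an error at the origin, tested on `u`, shows that `φ` sees the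
        -- origin. For `φ f = 0` the error must then vanish.
        have hδ : φ originIndicator ≠ 0 := fun h => by
          obtain ⟨_, _, _, h2⟩ := key u
          simp [h, hφu] at h2
        obtain ⟨g, e, hg, he⟩ := key f
        rw [hf, zero_add] at he
        rw [(mul_eq_zero.1 he).resolve_right hδ, zero_smul, add_zero] at hg
        exact ⟨g, hg⟩
      · rw [hlz]
        exact exists_sub_toeplitzOp_eq hs.ne' hz0 hz (hB h1) f
    obtain ⟨g, hg⟩ := hsolve (f - φ f • u) (by simp [hφu])
    refine ⟨g + ((φ f - φ g) / l) • u, ?_⟩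
    rw [happ]
    simp only [map_add, map_smul, hu, smul_add, hφu, smul_smul, add_smul, smul_eq_mul, mul_one]
    have h3 : l * ((φ f - φ g) / l) = φ f - φ g := mul_div_cancel₀ _ hl0
    rw [h3, sub_smul, add_sub_add_comm, hg]
    abel

/-- Gelfand's formula gives the bound for large n; the constant absorbs the finitely many remaining
powers. -/
lemma exists_norm_pow_le_of_spectrum {E : Type*} [NormedAddCommGroup E] [NormedSpace ℂ E]
    [CompleteSpace E] (T : E →L[ℂ] E) {R ρ : ℝ} (h : ∀ l ∈ spectrum ℂ T, ‖l‖ ≤ R)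
    (hR : 0 ≤ R) (hρ : R < ρ) : ∃ C > 0, ∀ n : ℕ, ‖T ^ n‖ ≤ C * ρ ^ n := by
  have hρ0 : 0 < ρ := hR.trans_lt hρ
  have hrad : spectralRadius ℂ T < ENNReal.ofReal ρ := by
    refine lt_of_le_of_lt (iSup₂_le fun l hl => ?_) ((ENNReal.ofReal_lt_ofReal_iff hρ0).2 hρ)
    rw [← enorm_eq_nnnorm, ← ofReal_norm]
    exact ENNReal.ofReal_le_ofReal (h l hl)
  have hev : ∀ᶠ n : ℕ in atTop, ‖T ^ n‖ ≤ ρ ^ n := by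
    filter_upwards [(spectrum.pow_norm_pow_one_div_tendsto_nhds_spectralRadius T).eventually_lt_const
      hrad, eventually_gt_atTop 0] with n hn hn0
    have h1 := ((ENNReal.ofReal_lt_ofReal_iff hρ0).1 hn).le
    calc ‖T ^ n‖ = (‖T ^ n‖ ^ (1 / n : ℝ)) ^ n := by
          rw [one_div, Real.rpow_inv_natCast_pow (norm_nonneg _) hn0.ne']
      _ ≤ ρ ^ n := by gcongr
  obtain ⟨N, hN⟩ := eventually_atTop.1 hev
  have hnn : ∀ n, 0 ≤ ‖T ^ n‖ / ρ ^ n := fun n => by positivity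
  refine ⟨1 + ∑ i ∈ Finset.range N, ‖T ^ i‖ / ρ ^ i,
    add_pos_of_pos_of_nonneg one_pos (Finset.sum_nonneg fun i _ => hnn i), fun n => ?_⟩
  have hS : 0 ≤ ∑ i ∈ Finset.range N, ‖T ^ i‖ / ρ ^ i := Finset.sum_nonneg fun i _ => hnn i
  rw [← div_le_iff₀ (by positivity)]
  rcases lt_or_ge n N with hn | hn
  · have := Finset.single_le_sum (fun i _ => hnn i) (Finset.mem_range.2 hn)
    linarith
  · have := (div_le_one₀ (pow_pos hρ0 n)).2 (hN n hn)
    linarith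

/-- Since `φ (Q ^ n g - φ g • u) = 0` at every stage, the rank-one correction never acts. -/
lemma deflation_pow_apply {E : Type*} [NormedAddCommGroup E] [NormedSpace ℂ E] {Q : E →L[ℂ] E}
    {φ : E →L[ℂ] ℂ} {u : E} (hφ : ∀ g, φ (Q g) = φ g) (hu : Q u = u) (hφu : φ u = 1) (n : ℕ)
    (g : E) : ((Q - φ.smulRight u) ^ n) (g - φ g • u) = (Q ^ n) g - φ g • u := by
  have hφQ : ∀ (n : ℕ) g, φ ((Q ^ n) g) = φ g := fun n => by
    induction n with
    | zero => simp
    | succ n ih => intro g; rw [pow_succ, mul_apply_eq_comp, ih, hφ]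
  induction n with
  | zero => simp
  | succ n ih =>
    rw [pow_succ', mul_apply_eq_comp, ih, pow_succ', mul_apply_eq_comp]
    simp only [sub_apply, ContinuousLinearMap.smulRight_apply, map_sub, map_smul, hu, hφQ, hφu]
    simp

lemma exists_norm_toeplitzOp_pow_sub_le (hr : 0 ≤ r) (hs : 0 < s) (hR : r + 2 * s ≤ R)
    (hφ : ∀ g, φ (toeplitzOp a b r s g) = φ g) (hu : toeplitzOp a b r s u = u) (hφu : φ u = 1)
    (hroot : ∀ z : ℂ, z ≠ 0 → ‖z‖ < 1 → r + s * (z + z⁻¹) = a + b * z →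
      R < ‖r + s * (z + z⁻¹)‖ → r + s * (z + z⁻¹) = 1) {ρ : ℝ} (hρ : R < ρ) :
    ∃ C > 0, ∀ (n : ℕ) (g : ℕ →ᵇ ℂ),
      ‖(toeplitzOp a b r s ^ n) g - φ g • u‖ ≤ C * ρ ^ n * ‖g‖ := by
  have hT : ∀ l ∈ spectrum ℂ (toeplitzOp a b r s - φ.smulRight u), ‖l‖ ≤ R := fun l hl =>
    spectrum_deflation_subset hr hs hR hφ hu hφu hroot hl
  obtain ⟨C, hC0, hC⟩ := exists_norm_pow_le_of_spectrum _ hT (by linarith) hρ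
  have hρ0 : 0 ≤ ρ := by linarith
  refine ⟨C * (1 + ‖φ‖ * ‖u‖), by positivity, fun n g => ?_⟩
  rw [← deflation_pow_apply hφ hu hφu]
  have hg : ‖g - φ g • u‖ ≤ (1 + ‖φ‖ * ‖u‖) * ‖g‖ := by
    have h1 := norm_sub_le g (φ g • u)
    rw [norm_smul] at h1
    have h2 := mul_le_mul_of_nonneg_right (φ.le_opNorm g) (norm_nonneg u)
    linarith
  calc ‖((toeplitzOp a b r s - φ.smulRight u) ^ n) (g - φ g • u)‖
      ≤ (C * ρ ^ n) * ((1 + ‖φ‖ * ‖u‖) * ‖g‖) :=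
        (ContinuousLinearMap.le_opNorm _ _).trans
          (mul_le_mul (hC n) hg (norm_nonneg _) (by positivity))
    _ = _ := by ring

end Deflation

end ToeplitzOperator

/-! ### Iterates of the kernel as powers of the conjugated operator -/

section Kernel

variable {a p r q γ s : ℝ}

lemma birthDeathKernel_zero : birthDeathKernel a p r q 0 =
    ENNReal.ofReal a • Measure.dirac 0 + ENNReal.ofReal (1 - a) • Measure.dirac 1 := rfl

lemma birthDeathKernel_succ (m : ℕ) : birthDeathKernel a p r q (m + 1) =
    ENNReal.ofReal p • Measure.dirac m + ENNReal.ofReal r • Measure.dirac (m + 1)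
      + ENNReal.ofReal q • Measure.dirac (m + 2) := rfl

lemma isMarkovKernel_birthDeathKernel (ha0 : 0 ≤ a) (ha1 : a ≤ 1) (hp : 0 ≤ p) (hr : 0 ≤ r)
    (hq : 0 ≤ q) (hsum : p + r + q = 1) : IsMarkovKernel (birthDeathKernel a p r q) := by
  refine ⟨fun n => ⟨?_⟩⟩
  rcases n with _ | n
  · rw [birthDeathKernel_zero]
    simp [← ENNReal.ofReal_add ha0 (sub_nonneg.2 ha1)]
  · rw [birthDeathKernel_succ]
    simp [← ENNReal.ofReal_add hp hr, ← ENNReal.ofReal_add (add_nonneg hp hr) hq, hsum]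

lemma birthDeathKernel_pow_succ_zero (n : ℕ) : (birthDeathKernel a p r q ^ (n + 1)) 0 =
    ENNReal.ofReal a • (birthDeathKernel a p r q ^ n) 0
      + ENNReal.ofReal (1 - a) • (birthDeathKernel a p r q ^ n) 1 := by
  rw [Kernel.pow_add, pow_one, Kernel.comp_apply, birthDeathKernel_zero, Measure.comp_add,
    Measure.bind_smul, Measure.bind_smul, Measure.dirac_bind (Kernel.measurable _),
    Measure.dirac_bind (Kernel.measurable _)]

lemma birthDeathKernel_pow_succ_succ (n m : ℕ) : (birthDeathKernel a p r q ^ (n + 1)) (m + 1) =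
    ENNReal.ofReal p • (birthDeathKernel a p r q ^ n) m
      + ENNReal.ofReal r • (birthDeathKernel a p r q ^ n) (m + 1)
      + ENNReal.ofReal q • (birthDeathKernel a p r q ^ n) (m + 2) := by
  rw [Kernel.pow_add, pow_one, Kernel.comp_apply, birthDeathKernel_succ, Measure.comp_add,
    Measure.comp_add, Measure.bind_smul, Measure.bind_smul, Measure.bind_smul,
    Measure.dirac_bind (Kernel.measurable _), Measure.dirac_bind (Kernel.measurable _),
    Measure.dirac_bind (Kernel.measurable _)]

/-- The iterates of the kernel, conjugated by the weight, are the powers of a Toeplitz operator. -/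
lemma integral_birthDeathKernel_pow (ha0 : 0 ≤ a) (ha1 : a ≤ 1) (hp : 0 ≤ p) (hr : 0 ≤ r)
    (hq : 0 ≤ q) (hpγ : p = s * γ) (hqγ : s = q * γ) (n : ℕ) (g : ℕ →ᵇ ℂ) (x : ℕ) :
    Integrable (fun y => (geometricWeight γ y : ℂ) * g y) ((birthDeathKernel a p r q ^ n) x) ∧
    ∫ y, (geometricWeight γ y : ℂ) * g y ∂((birthDeathKernel a p r q ^ n) x)
      = geometricWeight γ x * (toeplitzOp a ((1 - a) * γ) r s ^ n) g x := by
  -- Conditioning on the first step of the chain applies `toeplitzOp` last. Integrability is carried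
  -- along because splitting the integral over a sum of measures needs it.
  induction n generalizing x with
  | zero =>
    change Integrable _ (Measure.dirac x) ∧ ∫ y, _ ∂(Measure.dirac x) = _
    exact ⟨integrable_dirac (by rw [enorm_mul]; exact ENNReal.mul_lt_top enorm_lt_top enorm_lt_top),
      by simp⟩
  | succ n ih =>
    have hi : ∀ (c : ℝ) x, Integrable (fun y => (geometricWeight γ y : ℂ) * g y)
        (ENNReal.ofReal c • (birthDeathKernel a p r q ^ n) x) := fun c x =>
      (ih x).1.smul_measure ENNReal.ofReal_ne_top
    rw [pow_succ' (toeplitzOp _ _ _ _), mul_apply_eq_comp]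
    rcases x with _ | x
    · rw [birthDeathKernel_pow_succ_zero]
      refine ⟨(hi _ _).add_measure (hi _ _), ?_⟩
      rw [integral_add_measure (hi _ _) (hi _ _), integral_smul_measure, integral_smul_measure,
        (ih _).2, (ih _).2, ENNReal.toReal_ofReal ha0, ENNReal.toReal_ofReal (sub_nonneg.2 ha1),
        toeplitzOp_zero]
      simp only [geometricWeight, Complex.real_smul]
      push_cast
      ring
    · rw [birthDeathKernel_pow_succ_succ]
      refine ⟨((hi _ _).add_measure (hi _ _)).add_measure (hi _ _), ?_⟩
      rw [integral_add_measure ((hi _ _).add_measure (hi _ _)) (hi _ _),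
        integral_add_measure (hi _ _) (hi _ _), integral_smul_measure, integral_smul_measure,
        integral_smul_measure, (ih _).2, (ih _).2, (ih _).2, ENNReal.toReal_ofReal hp,
        ENNReal.toReal_ofReal hr, ENNReal.toReal_ofReal hq, toeplitzOp_succ]
      simp only [geometricWeight, Complex.real_smul]
      rw [hpγ, hqγ]
      push_cast
      ring

end Kernel

/-! ### Integration against π as a functional on bounded sequences -/

section Functional

variable {γ : ℝ} {π : Measure ℕ}

lemma norm_geometricWeight_mul_le (hγ : 0 ≤ γ) (g : ℕ →ᵇ ℂ) (x : ℕ) :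
    ‖(geometricWeight γ x : ℂ) * g x‖ ≤ geometricWeight γ x * ‖g‖ := by
  have h : 0 ≤ geometricWeight γ x := pow_nonneg hγ x
  rw [norm_mul, Complex.norm_real, Real.norm_of_nonneg h]
  gcongr
  exact g.norm_coe_le_norm x

lemma integrable_geometricWeight_mul (hγ : 0 ≤ γ) (hV : Integrable (geometricWeight γ) π)
    (g : ℕ →ᵇ ℂ) : Integrable (fun x => (geometricWeight γ x : ℂ) * g x) π :=
  (hV.mul_const ‖g‖).mono' (by fun_prop) (.of_forall (norm_geometricWeight_mul_le hγ g))

/-- Integration against a measure of the function `V g`, where `V` is the geometric weight. -/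
noncomputable def weightedIntegral (hγ : 0 ≤ γ) (hV : Integrable (geometricWeight γ) π) :
    (ℕ →ᵇ ℂ) →L[ℂ] ℂ :=
  LinearMap.mkContinuous
    { toFun := fun g => ∫ x, (geometricWeight γ x : ℂ) * g x ∂π
      map_add' := fun f g => by
        rw [← integral_add (integrable_geometricWeight_mul hγ hV f)
          (integrable_geometricWeight_mul hγ hV g)]
        simp [mul_add]
      map_smul' := fun c g => by
        simp only [BoundedContinuousFunction.coe_smul, RingHom.id_apply, smul_eq_mul]
        rw [← integral_const_mul]
        congr 1
        ext x
        ring }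
    (∫ x, geometricWeight γ x ∂π) (fun g => by
      rw [← integral_mul_const]
      exact norm_integral_le_of_norm_le (hV.mul_const ‖g‖)
        (.of_forall (norm_geometricWeight_mul_le hγ g)))

lemma weightedIntegral_apply (hγ : 0 ≤ γ) (hV : Integrable (geometricWeight γ) π) (g : ℕ →ᵇ ℂ) :
    weightedIntegral hγ hV g = ∫ x, (geometricWeight γ x : ℂ) * g x ∂π := rfl

lemma weightedIntegral_geometricSeq_inv [IsProbabilityMeasure π] (hγ : 1 ≤ γ)
    (hV : Integrable (geometricWeight γ) π) (h : ‖(γ : ℂ)⁻¹‖ ≤ 1) :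
    weightedIntegral (zero_le_one.trans hγ) hV (geometricSeq (γ : ℂ)⁻¹ h) = 1 := by
  have hγ0 : (γ : ℂ) ≠ 0 := Complex.ofReal_ne_zero.2 (by linarith)
  rw [weightedIntegral_apply]
  simp [geometricWeight, hγ0]

end Functional

/-! ### The V-deviation as an operator norm -/

section Deviation

variable {a p r q γ s : ℝ} {π : Measure ℕ}

lemma weightedIntegral_toeplitzOp (ha0 : 0 ≤ a) (ha1 : a ≤ 1) (hp : 0 ≤ p) (hr : 0 ≤ r)
    (hq : 0 ≤ q) (hsum : p + r + q = 1) (hγ : 0 ≤ γ) (hpγ : p = s * γ) (hqγ : s = q * γ)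
    (hV : Integrable (geometricWeight γ) π) [IsProbabilityMeasure π]
    (hπ : (birthDeathKernel a p r q).Invariant π) (g : ℕ →ᵇ ℂ) :
    weightedIntegral hγ hV (toeplitzOp a ((1 - a) * γ) r s g) = weightedIntegral hγ hV g := by
  have := isMarkovKernel_birthDeathKernel ha0 ha1 hp hr hq hsum
  have hI := integrable_geometricWeight_mul hγ hV g
  rw [weightedIntegral_apply, weightedIntegral_apply]
  conv_rhs => rw [← hπ.def]
  rw [← hπ.def] at hI
  rw [Measure.comp_eq_comp_const_apply] at hI ⊢
  rw [Kernel.integral_comp hI, Kernel.const_apply]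
  congr 1
  ext x
  simpa using (integral_birthDeathKernel_pow ha0 ha1 hp hr hq hpγ hqγ 1 g x).2.symm

lemma norm_integral_sub_div_geometricWeight (ha0 : 0 ≤ a) (ha1 : a ≤ 1) (hp : 0 ≤ p)
    (hr : 0 ≤ r) (hq : 0 ≤ q) (hγ : 1 ≤ γ) (hpγ : p = s * γ) (hqγ : s = q * γ)
    (hV : Integrable (geometricWeight γ) π) (h : ‖(γ : ℂ)⁻¹‖ ≤ 1) (n : ℕ) (g : ℕ →ᵇ ℂ) (x : ℕ) :
    ‖(∫ y, (geometricWeight γ y : ℂ) * g y ∂((birthDeathKernel a p r q ^ n) x))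
        - ∫ y, (geometricWeight γ y : ℂ) * g y ∂π‖ / geometricWeight γ x
      = ‖((toeplitzOp a ((1 - a) * γ) r s ^ n) g
        - weightedIntegral (zero_le_one.trans hγ) hV g • geometricSeq (γ : ℂ)⁻¹ h) x‖ := by
  have hγ0 : 0 < γ := by linarith
  have hγC : (γ : ℂ) ≠ 0 := Complex.ofReal_ne_zero.2 hγ0.ne'
  have hVx : 0 < geometricWeight γ x := pow_pos hγ0 x
  rw [(integral_birthDeathKernel_pow ha0 ha1 hp hr hq hpγ hqγ n g x).2,
    ← weightedIntegral_apply (zero_le_one.trans hγ) hV, div_eq_iff hVx.ne']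
  conv_rhs => rw [← Real.norm_of_nonneg hVx.le, ← Complex.norm_real, ← norm_mul]
  congr 1
  simp only [BoundedContinuousFunction.coe_sub, BoundedContinuousFunction.coe_smul,
    Pi.sub_apply, smul_eq_mul, geometricSeq_apply, geometricWeight, Complex.ofReal_pow, sub_mul]
  rw [mul_assoc (weightedIntegral _ _ _), ← mul_pow, inv_mul_cancel₀ hγC, one_pow]
  ring

lemma vDeviation_le (ha0 : 0 ≤ a) (ha1 : a ≤ 1) (hp : 0 ≤ p) (hr : 0 ≤ r)
    (hq : 0 ≤ q) (hγ : 1 ≤ γ) (hpγ : p = s * γ) (hqγ : s = q * γ)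
    (hV : Integrable (geometricWeight γ) π) (h : ‖(γ : ℂ)⁻¹‖ ≤ 1) (n : ℕ) {K : ℝ} (hK0 : 0 ≤ K)
    (hK : ∀ g : ℕ →ᵇ ℂ, ‖(toeplitzOp a ((1 - a) * γ) r s ^ n) g
      - weightedIntegral (zero_le_one.trans hγ) hV g • geometricSeq (γ : ℂ)⁻¹ h‖ ≤ K * ‖g‖) :
    vDeviation (birthDeathKernel a p r q) (geometricWeight γ) π n ≤ ENNReal.ofReal K := by
  have hVpos : ∀ x, 0 < geometricWeight γ x := fun x => pow_pos (by linarith) x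
  refine iSup_le fun f => iSup_le fun _ => iSup_le fun hf => iSup_le fun x => ?_
  -- Dividing by V identifies the unit ball of the V-norm with that of the bounded sequences.
  let g : ℕ →ᵇ ℂ := BoundedContinuousFunction.ofNormedAddCommGroupDiscrete
    (fun y => f y / geometricWeight γ y) 1 (fun y => by
      rw [norm_div, Complex.norm_real, Real.norm_of_nonneg (hVpos y).le]
      exact div_le_one_of_le₀ (hf y) (hVpos y).le)
  have hg : ‖g‖ ≤ 1 := BoundedContinuousFunction.norm_ofNormedAddCommGroup_le _ zero_le_one _
  have hfg : f = fun y => (geometricWeight γ y : ℂ) * g y := by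
    ext y
    exact (mul_div_cancel₀ _ (Complex.ofReal_ne_zero.2 (hVpos y).ne')).symm
  rw [hfg, norm_integral_sub_div_geometricWeight ha0 ha1 hp hr hq hγ hpγ hqγ hV h]
  exact ENNReal.ofReal_le_ofReal <| (BoundedContinuousFunction.norm_coe_le_norm _ x).trans <|
    (hK g).trans (mul_le_of_le_one_right hK0 hg)

lemma ofReal_norm_le_vDeviation (ha0 : 0 ≤ a) (ha1 : a ≤ 1) (hp : 0 ≤ p) (hr : 0 ≤ r)
    (hq : 0 ≤ q) (hγ : 1 ≤ γ) (hpγ : p = s * γ) (hqγ : s = q * γ)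
    (hV : Integrable (geometricWeight γ) π) (h : ‖(γ : ℂ)⁻¹‖ ≤ 1) (n : ℕ) {g : ℕ →ᵇ ℂ}
    (hg : ‖g‖ ≤ 1) (x : ℕ) :
    ENNReal.ofReal ‖((toeplitzOp a ((1 - a) * γ) r s ^ n) g
      - weightedIntegral (zero_le_one.trans hγ) hV g • geometricSeq (γ : ℂ)⁻¹ h) x‖
      ≤ vDeviation (birthDeathKernel a p r q) (geometricWeight γ) π n := by
  have hV0 : ∀ x, 0 ≤ geometricWeight γ x := fun x => pow_nonneg (by linarith) x
  have hb : ∀ y, ‖(geometricWeight γ y : ℂ) * g y‖ ≤ geometricWeight γ y := fun y =>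
    (norm_geometricWeight_mul_le (by linarith) g y).trans (mul_le_of_le_one_right (hV0 y) hg)
  rw [← norm_integral_sub_div_geometricWeight ha0 ha1 hp hr hq hγ hpγ hqγ hV h]
  exact le_iSup_of_le (fun y => (geometricWeight γ y : ℂ) * g y) <|
    le_iSup_of_le measurable_from_top <| le_iSup_of_le hb <| le_iSup_of_le x le_rfl

/-- An eigenvalue other than `1` of the conjugated kernel is a lower bound for every rate of
convergence. -/
lemma norm_eigenvalue_le_of_vDeviation_le (ha0 : 0 ≤ a) (ha1 : a ≤ 1) (hp : 0 ≤ p) (hr : 0 ≤ r)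
    (hq : 0 ≤ q) (hsum : p + r + q = 1) (hγ : 1 ≤ γ) (hpγ : p = s * γ) (hqγ : s = q * γ)
    (hV : Integrable (geometricWeight γ) π) [IsProbabilityMeasure π]
    (hπ : (birthDeathKernel a p r q).Invariant π) {g : ℕ →ᵇ ℂ} (hg0 : g 0 = 1) {l : ℂ}
    (hl1 : l ≠ 1) (hl : toeplitzOp a ((1 - a) * γ) r s g = l • g) {ρ c : ℝ} (hρ : 0 < ρ)
    (hdev : ∀ᶠ n : ℕ in atTop, vDeviation (birthDeathKernel a p r q) (geometricWeight γ) π n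
      ≤ ENNReal.ofReal (c * ρ ^ n)) : ‖l‖ ≤ ρ := by
  have hγ0 : 0 ≤ γ := zero_le_one.trans hγ
  have hinv : ‖(γ : ℂ)⁻¹‖ ≤ 1 := by
    rw [norm_inv, Complex.norm_real, Real.norm_of_nonneg hγ0]
    exact inv_le_one_of_one_le₀ hγ
  -- Invariance gives l φ(g) = φ(g) with l ≠ 1.
  have hφ : weightedIntegral hγ0 hV g = 0 := by
    have h1 := weightedIntegral_toeplitzOp ha0 ha1 hp hr hq hsum hγ0 hpγ hqγ hV hπ g
    rw [hl, map_smul, smul_eq_mul] at h1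
    have h2 : (l - 1) * weightedIntegral hγ0 hV g = 0 := by linear_combination h1
    exact (mul_eq_zero.1 h2).resolve_left (sub_ne_zero.2 hl1)
  have hpow : ∀ n : ℕ, (toeplitzOp a ((1 - a) * γ) r s ^ n) g = l ^ n • g := fun n => by
    induction n with
    | zero => simp
    | succ n ih => rw [pow_succ', mul_apply_eq_comp, ih, map_smul, hl, smul_smul, pow_succ]
  have hgpos : 0 < ‖g‖ := by
    have := g.norm_coe_le_norm 0
    rw [hg0, norm_one] at this
    linarith
  have hbound : ∀ᶠ n : ℕ in atTop, ‖l‖ ^ n ≤ ‖g‖ * (|c| * ρ ^ n) := by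
    filter_upwards [hdev] with n hn
    have h1 : ‖((‖g‖ : ℂ)⁻¹ • g)‖ ≤ 1 := by
      rw [norm_smul, norm_inv, Complex.norm_real, norm_norm, inv_mul_cancel₀ hgpos.ne']
    have h2 := (ofReal_norm_le_vDeviation ha0 ha1 hp hr hq hγ hpγ hqγ hV hinv n h1 0).trans hn
    rw [map_smul, map_smul, hφ, smul_zero, zero_smul, sub_zero, hpow] at h2
    simp only [BoundedContinuousFunction.coe_smul, smul_eq_mul, hg0, mul_one, norm_mul, norm_inv,
      norm_pow, Complex.norm_real, norm_norm] at h2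
    have h3 := h2.trans (ENNReal.ofReal_le_ofReal
      (mul_le_mul_of_nonneg_right (le_abs_self c) (pow_nonneg hρ.le n)))
    rw [ENNReal.ofReal_le_ofReal_iff (by positivity)] at h3
    rwa [inv_mul_le_iff₀ hgpos] at h3
  by_contra! hlt
  have h1 : 1 < ‖l‖ / ρ := (one_lt_div hρ).2 hlt
  obtain ⟨n, hn, hn'⟩ := (hbound.and
    ((tendsto_pow_atTop_atTop_of_one_lt h1).eventually_gt_atTop (‖g‖ * |c|))).exists
  rw [div_pow, lt_div_iff₀ (pow_pos hρ n)] at hn'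
  linarith

end Deviation

/-! ### An invariant probability measure integrating V -/

section Existence

/-- The reversible weights of the birth-and-death chain. -/
noncomputable def birthDeathWeight (a p q : ℝ) : ℕ → ℝ
  | 0 => 1
  | n + 1 => (1 - a) / p * (q / p) ^ n

/-- The reversible measure of the birth-and-death chain. -/
noncomputable def birthDeathMeasure (a p q : ℝ) : Measure ℕ :=
  Measure.sum fun n => ENNReal.ofReal (birthDeathWeight a p q n) • Measure.dirac n

variable {a p r q γ : ℝ}

lemma birthDeathWeight_nonneg (ha1 : a ≤ 1) (hp : 0 < p) (hq : 0 ≤ q) (n : ℕ) :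
    0 ≤ birthDeathWeight a p q n := by
  rcases n with _ | n
  · exact zero_le_one
  · have : 0 ≤ 1 - a := sub_nonneg.2 ha1
    unfold birthDeathWeight
    positivity

/-- Only neighbouring states feed mass into k, so each singleton is a finite sum. States 0 and 1 are
treated apart because both receive mass from the exceptional state 0. -/
lemma invariant_birthDeathMeasure (ha0 : 0 ≤ a) (ha1 : a ≤ 1) (hp : 0 < p) (hr : 0 ≤ r)
    (hq : 0 ≤ q) (hsum : p + r + q = 1) :
    (birthDeathKernel a p r q).Invariant (birthDeathMeasure a p q) := by
  have hw := birthDeathWeight_nonneg ha1 hp hq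
  have h1a : 0 ≤ 1 - a := sub_nonneg.2 ha1
  have hmul : ∀ n (x : ℝ), ENNReal.ofReal (birthDeathWeight a p q n) * ENNReal.ofReal x
      = ENNReal.ofReal (birthDeathWeight a p q n * x) := fun n x =>
    (ENNReal.ofReal_mul (hw n)).symm
  refine Measure.ext_of_singleton fun k => ?_
  have hbind : birthDeathKernel a p r q ∘ₘ birthDeathMeasure a p q
      = Measure.sum fun n => ENNReal.ofReal (birthDeathWeight a p q n)
        • birthDeathKernel a p r q n := by
    unfold birthDeathMeasure
    rw [Measure.bind_sum _ _ (Kernel.aemeasurable _)]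
    congr 1
    ext1 n
    rw [Measure.bind_smul, Measure.dirac_bind (Kernel.measurable _)]
  have hμ : birthDeathMeasure a p q {k} = ENNReal.ofReal (birthDeathWeight a p q k) := by
    unfold birthDeathMeasure
    rw [Measure.sum_apply _ (measurableSet_singleton k), tsum_eq_single k]
    · simp
    · intro n hn
      simp [hn]
  rw [hbind, hμ, Measure.sum_apply _ (measurableSet_singleton k)]
  have hpne : p ≠ 0 := hp.ne'
  rcases k with _ | _ | k
  · rw [tsum_eq_sum (s := {0, 1})]
    · have hP1 := birthDeathKernel_succ (a := a) (p := p) (r := r) (q := q) 0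
      rw [zero_add] at hP1
      rw [Finset.sum_pair zero_ne_one]
      simp only [Measure.smul_apply, smul_eq_mul, birthDeathKernel_zero, hP1, Measure.add_apply]
      simp only [Measure.dirac_apply, Set.indicator, Set.mem_singleton_iff]
      norm_num
      rw [hmul 0 a, hmul 1 p, ← ENNReal.ofReal_add (mul_nonneg (hw _) ha0)
        (mul_nonneg (hw _) hp.le)]
      congr 1
      simp only [birthDeathWeight]
      field_simp
      ring
    · intro n hn
      rcases n with _ | _ | n
      · simp at hn
      · simp at hn
      · simp [birthDeathKernel_succ]
  · rw [tsum_eq_sum (s := {0, 1, 2})]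
    · rw [Finset.sum_insert (by simp), Finset.sum_pair (by simp)]
      simp only [Measure.smul_apply, smul_eq_mul, birthDeathKernel_zero, birthDeathKernel_succ 0,
        birthDeathKernel_succ 1, Measure.add_apply]
      simp only [Measure.dirac_apply, Set.indicator, Set.mem_singleton_iff]
      norm_num
      rw [hmul 0, hmul 1 r, hmul 2 p, ← ENNReal.ofReal_add (mul_nonneg (hw _) hr)
        (mul_nonneg (hw _) hp.le), ← ENNReal.ofReal_add (mul_nonneg (hw _) h1a)
        (add_nonneg (mul_nonneg (hw _) hr) (mul_nonneg (hw _) hp.le))]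
      congr 1
      simp only [birthDeathWeight]
      field_simp
      linear_combination (1 - a) * hsum
    · intro n hn
      rcases n with _ | _ | _ | n
      · simp at hn
      · simp at hn
      · simp at hn
      · simp [birthDeathKernel_succ]
  · rw [tsum_eq_sum (s := {k + 1, k + 2, k + 3})]
    · rw [Finset.sum_insert (by simp), Finset.sum_pair (by simp)]
      simp only [Measure.smul_apply, smul_eq_mul, birthDeathKernel_succ, Measure.add_apply]
      have h2 : k ≠ k + 1 + 1 := by omega
      simp only [Measure.dirac_apply, Set.indicator, Set.mem_singleton_iff]
      norm_num [h2]
      rw [hmul _ q, hmul _ r, hmul _ p, ← ENNReal.ofReal_add (mul_nonneg (hw _) hr)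
        (mul_nonneg (hw _) hp.le), ← ENNReal.ofReal_add (mul_nonneg (hw _) hq)
        (add_nonneg (mul_nonneg (hw _) hr) (mul_nonneg (hw _) hp.le))]
      congr 1
      simp only [birthDeathWeight]
      have hx : q / p * p = q := div_mul_cancel₀ q hpne
      linear_combination (1 - a) / p * (q / p) ^ k * (q / p * hsum + (q / p - 1) * hx)
    · intro n hn
      rcases n with _ | n
      · simp [birthDeathKernel_zero]
      · simp only [Finset.mem_insert, Finset.mem_singleton, not_or] at hn
        have h1 : n ≠ k + 2 := by omega
        have h2 : n ≠ k + 1 := by omega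
        have h3 : n ≠ k := by omega
        simp [birthDeathKernel_succ, h1, h2, h3]

lemma integrable_birthDeathMeasure (ha1 : a ≤ 1) (hp : 0 < p) (hq : 0 ≤ q) (hγ : 0 ≤ γ)
    (hqγ : q * γ < p) : Integrable (geometricWeight γ) (birthDeathMeasure a p q) := by
  refine integrable_sum_dirac (fun _ => ENNReal.ofReal_ne_top) ?_
  simp_rw [ENNReal.toReal_ofReal (birthDeathWeight_nonneg ha1 hp hq _)]
  rw [← summable_nat_add_iff 1]
  have hs : Summable fun n : ℕ => (1 - a) / p * γ * (q * γ / p) ^ n :=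
    (summable_geometric_of_lt_one (by positivity) ((div_lt_one hp).2 hqγ)).mul_left _
  refine hs.congr fun n => ?_
  rw [geometricWeight, Real.norm_of_nonneg (pow_nonneg hγ _), birthDeathWeight]
  simp only [div_pow, mul_pow]
  ring

lemma exists_isVInvariantProbability (ha0 : 0 ≤ a) (ha1 : a ≤ 1) (hp : 0 < p) (hr : 0 ≤ r)
    (hq : 0 ≤ q) (hsum : p + r + q = 1) (hγ : 1 ≤ γ) (hqγ : q * γ < p) :
    ∃ π, IsVInvariantProbability (birthDeathKernel a p r q) (geometricWeight γ) π := by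
  set μ := birthDeathMeasure a p q with hμ
  have hV := integrable_birthDeathMeasure ha1 hp hq (zero_le_one.trans hγ) hqγ
  have hfin : IsFiniteMeasure μ := by
    have h1 : Integrable (fun _ : ℕ => (1 : ℝ)) μ :=
      hV.mono' (by fun_prop) (.of_forall fun n => by
        simpa [geometricWeight] using one_le_pow₀ hγ)
    exact (integrable_const_iff.1 h1).resolve_left one_ne_zero
  have hne : NeZero μ := ⟨fun h0 => by
    have h1 : ENNReal.ofReal (birthDeathWeight a p q 0) • Measure.dirac 0 ≤ μ := Measure.le_sum _ 0
    rw [h0] at h1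
    simpa [birthDeathWeight] using h1 {0}⟩
  refine ⟨(μ Set.univ)⁻¹ • μ, inferInstance, ?_, hV.smul_measure ?_⟩
  · change Measure.bind _ _ = _
    rw [Measure.bind_smul, (invariant_birthDeathMeasure ha0 ha1 hp hr hq hsum).def]
  · simp [NeZero.ne μ]

end Existence

/-! ### Geometric and trigonometric eigenvectors -/

section Eigenvectors

variable {a b r s : ℝ}

lemma toeplitzOp_geometricSeq {z : ℂ} (hz0 : z ≠ 0) (hz : ‖z‖ ≤ 1)
    (h : r + s * (z + z⁻¹) = a + b * z) :
    toeplitzOp a b r s (geometricSeq z hz) = (a + b * z) • geometricSeq z hz := by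
  ext n
  rcases n with _ | n
  · simp
  · have h1 : z * z⁻¹ = 1 := mul_inv_cancel₀ hz0
    rw [toeplitzOp_succ, ← h]
    simp only [geometricSeq_apply, BoundedContinuousFunction.coe_smul, smul_eq_mul]
    linear_combination (-s * z ^ n) * h1

lemma exists_trigonometric_eigenvector (hb : b ≠ 0) {θ : ℝ} (hθ : Real.sin θ ≠ 0) :
    ∃ g : ℕ →ᵇ ℂ, g 0 = 1 ∧
      toeplitzOp a b r s g = ((r + 2 * s * Real.cos θ : ℝ) : ℂ) • g := by
  -- Every combination of cos nθ and sin nθ solves the recursion; β is the coefficient that makes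
  -- the first row hold.
  set β := ((r + 2 * s * Real.cos θ - a) / b - Real.cos θ) / Real.sin θ with hβ
  let G : ℕ → ℝ := fun n => Real.cos (n * θ) + β * Real.sin (n * θ)
  have hG : ∀ n, ‖(G n : ℂ)‖ ≤ 1 + |β| := fun n => by
    rw [Complex.norm_real, Real.norm_eq_abs]
    refine (abs_add_le _ _).trans ?_
    rw [abs_mul]
    have h1 := Real.abs_cos_le_one (n * θ)
    have h2 := mul_le_of_le_one_right (abs_nonneg β) (Real.abs_sin_le_one (n * θ))
    linarith
  refine ⟨BoundedContinuousFunction.ofNormedAddCommGroupDiscrete (fun n => (G n : ℂ)) _ hG, ?_, ?_⟩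
  · change ((G 0 : ℝ) : ℂ) = 1
    simp [G]
  · ext n
    rcases n with _ | n
    · change (a : ℂ) * (G 0 : ℝ) + b * (G 1 : ℝ) = ((r + 2 * s * Real.cos θ : ℝ) : ℂ) * (G 0 : ℝ)
      have h0 : G 0 = 1 := by simp [G]
      have h1 : b * G 1 = r + 2 * s * Real.cos θ - a := by
        have hβ' : β * Real.sin θ = (r + 2 * s * Real.cos θ - a) / b - Real.cos θ :=
          div_mul_cancel₀ _ hθ
        simp only [G, Nat.cast_one, one_mul, hβ']
        field_simp
        ring
      rw [h0, ← Complex.ofReal_mul b, h1]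
      push_cast
      ring
    · change (s : ℂ) * (G n : ℝ) + r * (G (n + 1) : ℝ) + s * (G (n + 2) : ℝ)
        = ((r + 2 * s * Real.cos θ : ℝ) : ℂ) * (G (n + 1) : ℝ)
      norm_cast
      have h1 : G n + G (n + 2) = 2 * Real.cos θ * G (n + 1) := by
        have e1 : (n : ℝ) * θ = (n + 1 : ℕ) * θ - θ := by push_cast; ring
        have e2 : ((n + 2 : ℕ) : ℝ) * θ = (n + 1 : ℕ) * θ + θ := by push_cast; ring
        simp only [G]
        rw [e1, e2, Real.cos_add, Real.cos_sub, Real.sin_add, Real.sin_sub]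
        ring
      linear_combination s * h1

end Eigenvectors

/-! ### Upper and lower bounds for the convergence rate -/

section Rate

variable {a p r q γ s : ℝ} {π : Measure ℕ}

lemma add_two_mul_le_of_vDeviation_le (ha0 : 0 ≤ a) (ha1 : a < 1) (hp : 0 ≤ p) (hr : 0 ≤ r)
    (hq : 0 ≤ q) (hsum : p + r + q = 1) (hγ : 1 ≤ γ) (hs : 0 ≤ s) (hpγ : p = s * γ)
    (hqγ : s = q * γ) (hrs : r + 2 * s < 1)
    (hV : Integrable (geometricWeight γ) π) [IsProbabilityMeasure π]
    (hπ : (birthDeathKernel a p r q).Invariant π) {ρ c : ℝ} (hρ : 0 < ρ)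
    (hdev : ∀ᶠ n : ℕ in atTop, vDeviation (birthDeathKernel a p r q) (geometricWeight γ) π n
      ≤ ENNReal.ofReal (c * ρ ^ n)) : r + 2 * s ≤ ρ := by
  have hb : (1 - a) * γ ≠ 0 := mul_ne_zero (by linarith) (by linarith)
  have hlim : Tendsto (fun θ => r + 2 * s * Real.cos θ) (𝓝[>] 0) (𝓝 (r + 2 * s)) := by
    have : Continuous fun θ => r + 2 * s * Real.cos θ := by fun_prop
    simpa using (this.tendsto 0).mono_left nhdsWithin_le_nhds
  refine le_of_tendsto hlim ?_
  filter_upwards [Ioo_mem_nhdsGT Real.pi_pos] with θ hθ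
  obtain ⟨g, hg0, hg⟩ := exists_trigonometric_eigenvector (a := a) (r := r) (s := s) hb
    (Real.sin_pos_of_mem_Ioo hθ).ne'
  have h1 : r + 2 * s * Real.cos θ < 1 :=
    (add_le_add le_rfl (mul_le_of_le_one_right (by positivity) (Real.cos_le_one θ))).trans_lt hrs
  have h2 := norm_eigenvalue_le_of_vDeviation_le ha0 ha1.le hp hr hq hsum hγ hpγ hqγ hV hπ hg0
    (Complex.ofReal_eq_one.not.2 h1.ne) hg hρ hdev
  rw [Complex.norm_real] at h2
  exact (le_abs_self _).trans h2

/-- The roots of the boundary equation. -/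
lemma boundary_equation_iff (hpγ : p = s * γ) (hqγ : s = q * γ) (hsum : p + r + q = 1)
    {z : ℂ} (hz0 : z ≠ 0) :
    r + s * (z + z⁻¹) = a + ((1 - a) * γ : ℝ) * z ↔ γ * z = 1 ∨ (a - 1 + q) * z = s := by
  rw [← sub_eq_zero (a := (γ : ℂ) * z), ← sub_eq_zero (a := ((a : ℂ) - 1 + q) * z), ← mul_eq_zero,
    ← sub_eq_zero (a := (r : ℂ) + s * (z + z⁻¹)), ← mul_eq_zero_iff_left hz0]
  have hpC : (p : ℂ) = s * γ := by exact_mod_cast hpγ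
  have hqC : (s : ℂ) = q * γ := by exact_mod_cast hqγ
  have hsC : (p : ℂ) + r + q = 1 := by exact_mod_cast hsum
  have h1 : z * z⁻¹ = 1 := mul_inv_cancel₀ hz0
  -- The quadratic factors because z = 1/γ, coming from the constant function 1, is a known root.
  have key : z * (r + s * (z + z⁻¹) - (a + ((1 - a) * γ : ℝ) * z))
      = (γ * z - 1) * ((a - 1 + q) * z - s) := by
    push_cast
    linear_combination s * h1 + z * hsC - z * hpC + z ^ 2 * hqC
  rw [← key]

/-- The eigenvalue of the conjugated kernel outside the continuous spectrum, if there is one, is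
given by this expression. -/
noncomputable def boundaryEigenvalue (a p q : ℝ) : ℝ := a + p * (1 - a) / (a - 1 + q)

lemma ofReal_boundaryEigenvalue (hpγ : p = s * γ) {z : ℂ} (haq : a - 1 + q ≠ 0)
    (hz : (a - 1 + q) * z = s) :
    (boundaryEigenvalue a p q : ℂ) = a + ((1 - a) * γ : ℝ) * z := by
  have haqC : (a : ℂ) - 1 + q ≠ 0 := by exact_mod_cast haq
  have hpC : (p : ℂ) = s * γ := by exact_mod_cast hpγ
  unfold boundaryEigenvalue
  push_cast
  rw [hpC, ← hz]
  field_simp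

lemma norm_inv_le_one (hγ : 1 ≤ γ) : ‖(γ : ℂ)⁻¹‖ ≤ 1 := by
  rw [norm_inv, Complex.norm_real, Real.norm_of_nonneg (zero_le_one.trans hγ)]
  exact inv_le_one_of_one_le₀ hγ

lemma exists_vDeviation_le (ha0 : 0 ≤ a) (ha1 : a < 1) (hr : 0 ≤ r)
    (hq : 0 < q) (hsum : p + r + q = 1) (hγ : 1 < γ) (hpγ : p = s * γ)
    (hqγ : s = q * γ) (hπ : IsVInvariantProbability (birthDeathKernel a p r q) (geometricWeight γ) π)
    {R : ℝ} (hR : r + 2 * s ≤ R) (hRa : a < 1 - q - s → |boundaryEigenvalue a p q| ≤ R) {ρ : ℝ}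
    (hρ : R < ρ) :
    ∃ C > 0, ∀ n, vDeviation (birthDeathKernel a p r q) (geometricWeight γ) π n
      ≤ ENNReal.ofReal (C * ρ ^ n) := by
  have hγ0 : 0 < γ := one_pos.trans hγ
  have hs : 0 < s := hqγ ▸ mul_pos hq hγ0
  have hp : 0 < p := hpγ ▸ mul_pos hs hγ0
  have hqs : q < s := by rw [hqγ]; exact lt_mul_of_one_lt_right hq hγ
  have hγC : (γ : ℂ) ≠ 0 := Complex.ofReal_ne_zero.2 hγ0.ne'
  have hprob := hπ.isProbabilityMeasure
  have hinv := norm_inv_le_one hγ.le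
  have hu : toeplitzOp a ((1 - a) * γ) r s (geometricSeq (γ : ℂ)⁻¹ hinv)
      = geometricSeq (γ : ℂ)⁻¹ hinv := by
    rw [toeplitzOp_geometricSeq (inv_ne_zero hγC) hinv
      ((boundary_equation_iff hpγ hqγ hsum (inv_ne_zero hγC)).2 (Or.inl (mul_inv_cancel₀ hγC)))]
    push_cast
    rw [mul_assoc, mul_inv_cancel₀ hγC, mul_one, add_sub_cancel, one_smul]
  have hroot : ∀ z : ℂ, z ≠ 0 → ‖z‖ < 1 →
      r + s * (z + z⁻¹) = a + ((1 - a) * γ : ℝ) * z → R < ‖r + s * (z + z⁻¹)‖ →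
      r + s * (z + z⁻¹) = 1 := by
    intro z hz0 hz h hlt
    rcases (boundary_equation_iff hpγ hqγ hsum hz0).1 h with h1 | h1
    · rw [h]
      push_cast
      rw [mul_assoc, h1, mul_one, add_sub_cancel]
    · exfalso
      have h2 : |a - 1 + q| * ‖z‖ = s := by
        have := congrArg norm h1
        rwa [norm_mul, Complex.norm_real, Real.norm_of_nonneg hs.le, ← Complex.ofReal_one,
          ← Complex.ofReal_sub, ← Complex.ofReal_add, Complex.norm_real, Real.norm_eq_abs] at this
      have h3 : s < |a - 1 + q| := by
        have h0 : 0 < |a - 1 + q| := by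
          refine (abs_nonneg _).lt_of_ne fun h0 => ?_
          rw [← h0, zero_mul] at h2
          exact hs.ne h2
        rw [← h2]
        exact mul_lt_of_lt_one_right h0 hz
      -- The other sign is impossible, since a - 1 + q < q < s.
      have h4 : a < 1 - q - s := by
        rcases lt_abs.1 h3 with h | h <;> linarith
      have h5 := hRa h4
      rw [h, ← ofReal_boundaryEigenvalue hpγ (by linarith) h1, Complex.norm_real] at hlt
      exact h5.not_gt hlt
  have hγ1 := hγ.le
  obtain ⟨C, hC0, hC⟩ := exists_norm_toeplitzOp_pow_sub_le hr hs hR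
    (weightedIntegral_toeplitzOp ha0 ha1.le hp.le hr hq.le hsum (zero_le_one.trans hγ1) hpγ hqγ
      hπ.integrable hπ.invariant) hu
    (weightedIntegral_geometricSeq_inv hγ1 hπ.integrable hinv) hroot hρ
  have hρ0 : 0 ≤ ρ := by linarith
  exact ⟨C, hC0, fun n => vDeviation_le ha0 ha1.le hp.le hr hq.le hγ1 hpγ hqγ hπ.integrable hinv n
    (by positivity) (hC n)⟩

lemma abs_boundaryEigenvalue_le_of_vDeviation_le (ha0 : 0 ≤ a) (ha1 : a < 1) (hr : 0 ≤ r)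
    (hq : 0 < q) (hsum : p + r + q = 1) (hγ : 1 < γ) (hpγ : p = s * γ)
    (hqγ : s = q * γ) (hπ : IsVInvariantProbability (birthDeathKernel a p r q) (geometricWeight γ) π)
    (ha : a < 1 - q - s) (hne : boundaryEigenvalue a p q ≠ 1) {ρ c : ℝ} (hρ : 0 < ρ)
    (hdev : ∀ᶠ n : ℕ in atTop, vDeviation (birthDeathKernel a p r q) (geometricWeight γ) π n
      ≤ ENNReal.ofReal (c * ρ ^ n)) : |boundaryEigenvalue a p q| ≤ ρ := by
  have hγ0 : 0 < γ := one_pos.trans hγ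
  have hs : 0 < s := hqγ ▸ mul_pos hq hγ0
  have hp : 0 < p := hpγ ▸ mul_pos hs hγ0
  have hprob := hπ.isProbabilityMeasure
  have haq : a - 1 + q ≠ 0 := by linarith
  set z : ℂ := ((s / (a - 1 + q) : ℝ) : ℂ) with hz
  have hz0 : z ≠ 0 := Complex.ofReal_ne_zero.2 (div_ne_zero hs.ne' haq)
  have hzs : (a - 1 + q) * z = s := by
    rw [hz]
    exact_mod_cast mul_div_cancel₀ s haq
  have hz1 : ‖z‖ ≤ 1 := by
    rw [hz, Complex.norm_real, Real.norm_eq_abs, abs_div, abs_of_pos hs,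
      abs_of_neg (by linarith : a - 1 + q < 0)]
    exact div_le_one_of_le₀ (by linarith) (by linarith)
  have hev := toeplitzOp_geometricSeq hz0 hz1
    ((boundary_equation_iff hpγ hqγ hsum hz0).2 (Or.inr hzs))
  rw [← ofReal_boundaryEigenvalue hpγ haq hzs] at hev
  have := norm_eigenvalue_le_of_vDeviation_le ha0 ha1.le hp.le hr hq.le hsum hγ.le hpγ hqγ
    hπ.integrable hπ.invariant (pow_zero z) (Complex.ofReal_eq_one.not.2 hne) hev hρ hdev
  rwa [Complex.norm_real] at this

lemma vConvergenceRate_eq (ha0 : 0 ≤ a) (ha1 : a < 1) (hr : 0 ≤ r)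
    (hq : 0 < q) (hsum : p + r + q = 1) (hγ : 1 < γ) (hpγ : p = s * γ)
    (hqγ : s = q * γ) (hπ : IsVInvariantProbability (birthDeathKernel a p r q) (geometricWeight γ) π)
    {R : ℝ} (hR : r + 2 * s ≤ R) (hR1 : R < 1)
    (hRa : a < 1 - q - s → |boundaryEigenvalue a p q| ≤ R)
    (hR' : R = r + 2 * s ∨ a < 1 - q - s ∧ R = |boundaryEigenvalue a p q|) :
    vConvergenceRate (birthDeathKernel a p r q) (geometricWeight γ) π = R := by
  have hγ0 : 0 < γ := one_pos.trans hγ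
  have hs : 0 < s := hqγ ▸ mul_pos hq hγ0
  have hp : 0 < p := hpγ ▸ mul_pos hs hγ0
  have hprob := hπ.isProbabilityMeasure
  have hmem : Set.Ioo R 1 ⊆ {ρ : ℝ | ρ ∈ Set.Ioo (0 : ℝ) 1 ∧ ∃ c : ℝ, ∀ᶠ n : ℕ in atTop,
      vDeviation (birthDeathKernel a p r q) (geometricWeight γ) π n
        ≤ ENNReal.ofReal (c * ρ ^ n)} := fun ρ hρ => by
    obtain ⟨C, -, hC⟩ := exists_vDeviation_le ha0 ha1 hr hq hsum hγ hpγ hqγ hπ hR hRa hρ.1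
    exact ⟨⟨by linarith [hρ.1], hρ.2⟩, C, .of_forall hC⟩
  have hlb : ∀ ρ ∈ {ρ : ℝ | ρ ∈ Set.Ioo (0 : ℝ) 1 ∧ ∃ c : ℝ, ∀ᶠ n : ℕ in atTop,
      vDeviation (birthDeathKernel a p r q) (geometricWeight γ) π n
        ≤ ENNReal.ofReal (c * ρ ^ n)}, R ≤ ρ := by
    rintro ρ ⟨hρ, c, hc⟩
    rcases hR' with rfl | ⟨ha, rfl⟩
    · exact add_two_mul_le_of_vDeviation_le ha0 ha1 hp.le hr hq.le hsum hγ.le hs.le hpγ hqγ hR1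
        hπ.integrable hπ.invariant hρ.1 hc
    · exact abs_boundaryEigenvalue_le_of_vDeviation_le ha0 ha1 hr hq hsum hγ hpγ hqγ hπ ha
        ((le_abs_self _).trans_lt hR1).ne hρ.1 hc
  refine csInf_eq_of_forall_ge_of_forall_gt_exists_lt ((Set.nonempty_Ioo.2 hR1).mono hmem) hlb
    fun w hw => ?_
  obtain ⟨ρ, h1, h2⟩ := exists_between (lt_min hR1 hw)
  exact ⟨ρ, hmem ⟨h1, h2.trans_le (min_le_left _ _)⟩, h2.trans_le (min_le_right _ _)⟩

end Rate

/-! ### Comparing the boundary eigenvalue with 1 and with r + 2s -/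

section Eigenvalue

variable {a p r q s : ℝ}

lemma boundaryEigenvalue_eq (hpq : p * q = s ^ 2) (hsum : p + r + q = 1) (ha : a ≠ 1 - q) :
    boundaryEigenvalue a p q = r - ((1 - q - a) + s ^ 2 / (1 - q - a)) := by
  have h1 : 1 - q - a ≠ 0 := fun h => ha (by linarith)
  have h2 : a - 1 + q ≠ 0 := fun h => ha (by linarith)
  have h3 : r = 1 - p - q := by linarith
  unfold boundaryEigenvalue
  rw [h3, show a - 1 + q = -(1 - q - a) by ring, ← hpq]
  field_simp
  ring

lemma abs_boundaryEigenvalue_lt_one (ha0 : 0 < a) (ha1 : a < 1) (hr : 0 ≤ r) (hs : 0 < s)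
    (hqs : q < s) (hpq : p * q = s ^ 2) (hsum : p + r + q = 1) (ha : a < 1 - q - s) (hr1 : r < 1) :
    |boundaryEigenvalue a p q| < 1 := by
  have hd : 0 < 1 - q - a := by linarith
  rw [boundaryEigenvalue_eq hpq hsum (by linarith), abs_lt]
  have h1 : 0 ≤ s ^ 2 / (1 - q - a) := by positivity
  refine ⟨?_, by linarith⟩
  have h2 : 1 - q - a + s ^ 2 / (1 - q - a) < 1 + r := by
    rw [← lt_sub_iff_add_lt', div_lt_iff₀ hd, ← hpq]
    -- The right side is r(1 - a) + a(p + r - q - a), and p + r - a > s > q.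
    have h3 : (1 + r - (1 - q - a)) * (1 - q - a) - p * q = r + a * (p - q - a) := by
      have : p = 1 - r - q := by linarith
      rw [this]
      ring
    have h4 : 0 < a * (p - q - a + r) := mul_pos ha0 (by linarith)
    nlinarith
  linarith

lemma abs_boundaryEigenvalue_le_iff (hr : 0 ≤ r) (hs : 0 < s) (hpq : p * q = s ^ 2)
    (hsum : p + r + q = 1) (ha : a ≤ 1 - q - s) :
    |boundaryEigenvalue a p q| ≤ r + 2 * s ↔ p - s - √(r * (r + 2 * s)) ≤ a := by
  have hd : 0 < 1 - q - a := by linarith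
  have h1 : 0 ≤ s ^ 2 / (1 - q - a) := by positivity
  have hiff : 1 - q - a + s ^ 2 / (1 - q - a) ≤ 2 * r + 2 * s ↔
      (1 - q - a - (r + s)) ^ 2 ≤ r * (r + 2 * s) := by
    rw [← le_sub_iff_add_le', div_le_iff₀ hd]
    constructor <;> intro h <;> nlinarith
  rw [boundaryEigenvalue_eq hpq hsum (by linarith), abs_le]
  -- Here 1 - q - a - (r + s) = p - s - a, which is at least -r because a ≤ a₀; so only the upper
  -- half of the square-root condition matters, and it reads a₁ ≤ a.
  have h2 : -√(r * (r + 2 * s)) ≤ 1 - q - a - (r + s) := by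
    have : r ≤ √(r * (r + 2 * s)) := Real.le_sqrt_of_sq_le (by nlinarith)
    linarith
  constructor
  · rintro ⟨h, -⟩
    have := Real.le_sqrt_of_sq_le (hiff.1 (by linarith))
    linarith
  · intro h
    have h3 := hiff.2 (Real.sq_le (by positivity) |>.2 ⟨h2, by linarith⟩)
    exact ⟨by linarith, by linarith⟩

lemma le_abs_boundaryEigenvalue (hs : 0 < s) (hpq : p * q = s ^ 2)
    (hsum : p + r + q = 1) (ha : a ≤ 1 - q - s) (ha₁ : a ≤ p - s - √(r * (r + 2 * s))) :
    r + 2 * s ≤ |boundaryEigenvalue a p q| := by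
  have hd : 0 < 1 - q - a := by linarith
  rw [boundaryEigenvalue_eq hpq hsum (by linarith), le_abs]
  right
  have h1 : r * (r + 2 * s) ≤ (1 - q - a - (r + s)) ^ 2 := by
    rw [← Real.sqrt_le_left (by linarith [Real.sqrt_nonneg (r * (r + 2 * s))])]
    linarith
  have h2 : 2 * r + 2 * s ≤ 1 - q - a + s ^ 2 / (1 - q - a) := by
    rw [← sub_le_iff_le_add', le_div_iff₀ hd]
    nlinarith
  linarith

/-- The hypothesis is r(r + 2s) ≥ (p - s)² rewritten, so in this case a₁ ≤ 0 < a. -/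
lemma sub_sqrt_nonpos (hpq : p * q = s ^ 2) (hsum : p + r + q = 1)
    (h : 2 * p ≤ (1 - q + s) ^ 2) : p - s - √(r * (r + 2 * s)) ≤ 0 := by
  rw [sub_nonpos]
  refine Real.le_sqrt_of_sq_le ?_
  have h1 : r * (r + 2 * s) - (p - s) ^ 2 = (1 - q + s) ^ 2 - 2 * p := by
    have : r = 1 - p - q := by linarith
    rw [this]
    linear_combination 2 * hpq
  linarith

end Eigenvalue

/-! ### Assembly of the cases -/

theorem proposition6 (a p r q : ℝ) (hr : 0 ≤ r) (hq : 0 < q) (hqp : q < p)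
    (hsum : p + r + q = 1) (ha0 : 0 < a) (ha1 : a < 1)
    (a₀ a₁ : ℝ) (ha₀ : a₀ = 1 - q - √(p * q))
    (ha₁ : a₁ = p - √(p * q) - √(r * (r + 2 * √(p * q)))) :
    IsVGeometricallyErgodic (birthDeathKernel a p r q) (geometricWeight √(p / q)) ∧
    ∀ π : Measure ℕ,
      IsVInvariantProbability (birthDeathKernel a p r q) (geometricWeight √(p / q)) π →
      (a₀ < a →
        vConvergenceRate (birthDeathKernel a p r q) (geometricWeight √(p / q)) π
          = r + 2 * √(p * q)) ∧
      (a ≤ a₀ →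
        (2 * p ≤ (1 - q + √(p * q)) ^ 2 →
          vConvergenceRate (birthDeathKernel a p r q) (geometricWeight √(p / q)) π
            = r + 2 * √(p * q)) ∧
        ((1 - q + √(p * q)) ^ 2 < 2 * p →
          (a ≤ a₁ →
            vConvergenceRate (birthDeathKernel a p r q) (geometricWeight √(p / q)) π
              = |a + p * (1 - a) / (a - 1 + q)|) ∧
          (a₁ ≤ a →
            vConvergenceRate (birthDeathKernel a p r q) (geometricWeight √(p / q)) π
              = r + 2 * √(p * q)))) := by
  have hp : 0 < p := hq.trans hqp
  have hγ : 1 < √(p / q) := by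
    rw [Real.lt_sqrt zero_le_one, one_pow]
    exact (one_lt_div hq).2 hqp
  have hpq : p * q = √(p * q) ^ 2 := (Real.sq_sqrt (by positivity)).symm
  have hqγ : √(p * q) = q * √(p / q) := by
    rw [Real.sqrt_eq_iff_mul_self_eq (by positivity) (by positivity)]
    have := Real.mul_self_sqrt (div_nonneg hp.le hq.le)
    rw [mul_mul_mul_comm, this]
    field_simp
  have hpγ : p = √(p * q) * √(p / q) := by
    have := Real.mul_self_sqrt (div_nonneg hp.le hq.le)
    rw [hqγ, mul_assoc, this]
    field_simp
  generalize √(p / q) = γ at *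
  generalize √(p * q) = s at *
  subst ha₀ ha₁
  have hγ0 : 0 < γ := one_pos.trans hγ
  have hs : 0 < s := hqγ ▸ mul_pos hq hγ0
  have hqs : q < s := by rw [hqγ]; exact lt_mul_of_one_lt_right hq hγ
  have hsp : s < p := by rw [hpγ]; exact lt_mul_of_one_lt_right hs hγ
  have hrs : r + 2 * s < 1 := by
    -- The product expands to p + q - 2s, and p + q = 1 - r.
    have h2 : 0 < (s - q) * (γ - 1) := mul_pos (by linarith) (by linarith)
    linarith
  have hlt : a < 1 - q - s → |boundaryEigenvalue a p q| < 1 := fun h =>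
    abs_boundaryEigenvalue_lt_one ha0 ha1 hr hs hqs hpq hsum h (by linarith)
  refine ⟨⟨fun n x => ?_, ?_⟩, fun π hπ => ?_⟩
  -- The bounded sequence constantly equal to 1 corresponds to V itself.
  · have h := (integral_birthDeathKernel_pow ha0.le ha1.le hp.le hr hq.le hpγ hqγ n
      (geometricSeq 1 (by simp)) x).1.re
    simpa using h
  · obtain ⟨π, hπ⟩ := exists_isVInvariantProbability ha0.le ha1.le hp hr hq.le hsum hγ.le
      (by rwa [← hqγ])
    obtain ⟨R, hR, hR1, hRa⟩ : ∃ R, r + 2 * s ≤ R ∧ R < 1 ∧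
        (a < 1 - q - s → |boundaryEigenvalue a p q| ≤ R) := by
      by_cases h : a < 1 - q - s
      · exact ⟨_, le_max_left _ _, max_lt hrs (hlt h), fun _ => le_max_right _ _⟩
      · exact ⟨_, le_rfl, hrs, fun h' => absurd h' h⟩
    obtain ⟨ρ, hρ, hρ1⟩ := exists_between hR1
    obtain ⟨C, hC0, hC⟩ := exists_vDeviation_le ha0.le ha1 hr hq hsum hγ hpγ hqγ hπ hR hRa hρ
    exact ⟨π, hπ, ρ, ⟨by linarith, hρ1⟩, C, hC0, hC⟩
  · have hrate : p - s - √(r * (r + 2 * s)) ≤ a →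
        vConvergenceRate (birthDeathKernel a p r q) (geometricWeight γ) π = r + 2 * s := fun h =>
      vConvergenceRate_eq ha0.le ha1 hr hq hsum hγ hpγ hqγ hπ le_rfl hrs
        (fun h' => (abs_boundaryEigenvalue_le_iff hr hs hpq hsum h'.le).2 h) (Or.inl rfl)
    refine ⟨fun h => ?_, fun h => ⟨fun h2 => ?_, fun _ => ⟨fun h3 => ?_, hrate⟩⟩⟩
    · exact vConvergenceRate_eq ha0.le ha1 hr hq hsum hγ hpγ hqγ hπ le_rfl hrs
        (fun h' => absurd h' h.not_gt) (Or.inl rfl)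
    · exact hrate ((sub_sqrt_nonpos hpq hsum h2).trans ha0.le)
    · have hle := le_abs_boundaryEigenvalue hs hpq hsum h h3
      rcases h.lt_or_eq with h' | h'
      · exact vConvergenceRate_eq ha0.le ha1 hr hq hsum hγ hpγ hqγ hπ hle (hlt h')
          (fun _ => le_rfl) (Or.inr ⟨h', rfl⟩)
      -- At a = a₀ the root z lies on the unit circle, outside the eigenvalue case of
      -- `vConvergenceRate_eq`; both comparisons hold there, so the two candidate rates coincide.
      · have hr0 : p - s - √(r * (r + 2 * s)) ≤ a := by
          have := Real.sqrt_nonneg (r * (r + 2 * s))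
          linarith
        have heq := hle.antisymm' ((abs_boundaryEigenvalue_le_iff hr hs hpq hsum h).2 hr0)
        exact (hrate hr0).trans heq.symm
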